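/- Let $n \ge 5$, and let $\mathcal{T}_n$ be the set of all spanning trees of the complete graph $K_n$ on $n$ labelled vertices. A forest of $K_n$ is an acyclic subgraph of $K_n$. It is called $6$-star-like if it has an edge that shares an endpoint with at least $(n-1)/6$ other edges of the forest. Two subgraphs of $K_n$ avoid each other if they have no edge in common. For forests $T_0$ and $F$ of $K_n$, let \[ \mathcal{T}_n[T_0;F] = \{\, T \in \mathcal{T}_n : F \subseteq T,\ (T\cap T_0)\setminus F = \emptyset \,\}, \] where forests and trees are identified with their edge sets. Suppose that $T_0$ is a forest of $K_n$ that is not $6$-star-like. Then at least $e^{-4}n^{n-2}$ of the trees $T\in\mathcal{T}_n$ avoid $T_0$; in particular, \[ \bigl|\mathcal{T}_n[T_0;\emptyset]\bigr| \ge e^{-4}\, n^{n-2}. \] -/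

import Mathlib

/-- The set of spanning trees of the complete graph on `n` labelled vertices. -/
def spanningTrees (n : ℕ) : Set (SimpleGraph (Fin n)) :=
  {T | T.IsTree}

/-- The spanning trees of the complete graph whose edges include all the edges of `F`. -/
def spanningTreesContaining {n : ℕ} (F : SimpleGraph (Fin n)) : Set (SimpleGraph (Fin n)) :=
  {T | T ∈ spanningTrees n ∧ F.edgeSet ⊆ T.edgeSet}

/-- The spanning trees that contain `F` and have no edge in common with `T₀` outside of `F`. -/
def spanningTreesContainingAvoiding {n : ℕ} (T₀ F : SimpleGraph (Fin n)) :
    Set (SimpleGraph (Fin n)) :=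
  {T | T ∈ spanningTreesContaining F ∧ (T.edgeSet ∩ T₀.edgeSet) \ F.edgeSet = ∅}

/-- Two graphs on the same vertices avoid each other if they have no edge in common. -/
def Avoids {n : ℕ} (T T₀ : SimpleGraph (Fin n)) : Prop :=
  Disjoint T.edgeSet T₀.edgeSet

/-- The edges of `T`, other than `e`, that share an endpoint with `e`. -/
def otherIncidentEdges {n : ℕ} (T : SimpleGraph (Fin n)) (e : Sym2 (Fin n)) :
    Set (Sym2 (Fin n)) :=
  {e' | e' ∈ T.edgeSet ∧ e' ≠ e ∧ ∃ v, v ∈ e ∧ v ∈ e'}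

/-- A forest of the complete graph on `n` vertices is `d`-star-like if some edge of it is
incident to at least `(n - 1) / d` of its other edges. -/
def IsStarLike {n : ℕ} (d : ℕ) (T : SimpleGraph (Fin n)) : Prop :=
  ∃ e ∈ T.edgeSet, ((n : ℝ) - 1) / (d : ℝ) ≤ ((otherIncidentEdges T e).ncard : ℝ)

/-! A tree avoids `T₀` exactly when it is a spanning tree of the complement `H` of `T₀`, so a
matrix-tree argument applies. If `A` is the oriented incidence matrix of `H` with a column of ones
added, then `A * Aᵀ` is the Laplacian of `H` plus the all-ones matrix, which equals `n • 1` minus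
the Laplacian of `T₀`. Cauchy–Binet gives `det (A * Aᵀ) ≤ n ^ 2 * τ(H)`, where `τ` counts spanning
trees; only this inequality is needed.

For the lower bound, write the eigenvalues as `n * (1 - x i)`. As `T₀` has fewer than `n` edges, the
trace gives `∑ x i ≤ 2`. Not being star-like bounds the degrees by `n / 3`, so Gershgorin gives `0 ≤
x i ≤ 2 / 3`. There `1 - x ≥ exp (-2 * x)`, hence the determinant is at least `exp (-4) * n ^ n`. -/

/-! ### Cauchy–Binet -/

open Finset Matrix SimpleGraph in
/-- The Cauchy–Binet formula for `A * Aᵀ`, as a sum over all column selections. -/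
lemma factorial_mul_det_mul_transpose {V ι : Type*} [Fintype V] [DecidableEq V] [Fintype ι]
    [DecidableEq ι] (A : Matrix V ι ℝ) :
    ((Fintype.card V).factorial : ℝ) * (A * Aᵀ).det = ∑ f : V → ι, (A.submatrix id f).det ^ 2 := by
  have hexp : (A * Aᵀ).det = ∑ f : V → ι, (∏ i, A i (f i)) * (A.submatrix id f).det := by
    simp only [det_apply', mul_apply, prod_univ_sum, mul_sum, Fintype.piFinset_univ]
    rw [Finset.sum_comm]
    refine sum_congr rfl fun f _ => sum_congr rfl fun σ _ => ?_
    simp only [transpose_apply, submatrix_apply, id, prod_mul_distrib]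
    ring
  -- Reindexing the selections by `σ` costs only a sign; summing over all `σ` turns the product into
  -- a second determinant.
  have hperm (σ : Equiv.Perm V) : (A * Aᵀ).det =
      ∑ f : V → ι, ((Equiv.Perm.sign σ : ℤ) : ℝ) * (∏ i, A i (f (σ i))) *
        (A.submatrix id f).det := by
    rw [hexp, ← (Equiv.arrowCongr σ.symm (Equiv.refl ι)).sum_comp]
    refine sum_congr rfl fun f _ => ?_
    have h := det_permute' σ (A.submatrix id f)
    have h' : (A.submatrix id f).submatrix id σ =
        A.submatrix id ((Equiv.arrowCongr σ.symm (Equiv.refl ι)) f) := by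
      ext; simp
    rw [← h', h]
    simp
    ring
  have hrow (f : V → ι) : (A.submatrix id f).det =
      ∑ σ : Equiv.Perm V, ((Equiv.Perm.sign σ : ℤ) : ℝ) * ∏ i, A i (f (σ i)) := by
    rw [← det_transpose, det_apply']; rfl
  calc ((Fintype.card V).factorial : ℝ) * (A * Aᵀ).det
      = ∑ _σ : Equiv.Perm V, (A * Aᵀ).det := by
        rw [sum_const, card_univ, Fintype.card_perm, nsmul_eq_mul]
    _ = ∑ σ : Equiv.Perm V, ∑ f : V → ι, ((Equiv.Perm.sign σ : ℤ) : ℝ) * (∏ i, A i (f (σ i))) *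
        (A.submatrix id f).det := sum_congr rfl fun σ _ => hperm σ
    _ = ∑ f : V → ι, (A.submatrix id f).det ^ 2 := by
        rw [sum_comm]
        refine sum_congr rfl fun f _ => ?_
        rw [← sum_mul, ← hrow, sq]

/-! ### Unimodularity of incidence matrices -/

/-- A vector with at most one entry `1`, at most one entry `-1`, and all other entries `0`. -/
def IsArcVector {V : Type*} (c : V → ℝ) : Prop :=
  (∀ i, c i = 0 ∨ c i = 1 ∨ c i = -1) ∧ (∀ i j, c i = 1 → c j = 1 → i = j) ∧
    ∀ i j, c i = -1 → c j = -1 → i = j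

lemma IsArcVector.comp {V W : Type*} {c : V → ℝ} (hc : IsArcVector c) {g : W → V}
    (hg : Function.Injective g) : IsArcVector (fun i => c (g i)) :=
  ⟨fun _ => hc.1 _, fun _ _ h h' => hg (hc.2.1 _ _ h h'), fun _ _ h h' => hg (hc.2.2 _ _ h h')⟩

lemma IsArcVector.abs_le_one {V : Type*} {c : V → ℝ} (hc : IsArcVector c) (i : V) :
    |c i| ≤ 1 := by
  rcases hc.1 i with h | h | h <;> simp [h]

lemma IsArcVector.sum_eq_zero_or_eq_zero_off {V : Type*} [Fintype V] [DecidableEq V] [Nonempty V]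
    {c : V → ℝ} (hc : IsArcVector c) : ∑ i, c i = 0 ∨ ∃ i, ∀ j, j ≠ i → c j = 0 := by
  obtain ⟨h0, h1, h2⟩ := hc
  by_cases ha : ∃ a, c a = 1
  · obtain ⟨a, ha⟩ := ha
    by_cases hb : ∃ b, c b = -1
    · obtain ⟨b, hb⟩ := hb
      left
      have hab : a ≠ b := by rintro rfl; linarith
      rw [Finset.sum_eq_add (s := Finset.univ) a b hab]
      · simp [ha, hb]
      · intro j _ hj
        rcases h0 j with h | h | h
        · exact h
        · exact absurd (h1 _ _ h ha) hj.1
        · exact absurd (h2 _ _ h hb) hj.2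
      · simp
      · simp
    · refine Or.inr ⟨a, fun j hj => ?_⟩
      rcases h0 j with h | h | h
      · exact h
      · exact absurd (h1 _ _ h ha) hj
      · exact absurd ⟨j, h⟩ hb
  · by_cases hb : ∃ b, c b = -1
    · obtain ⟨b, hb⟩ := hb
      refine Or.inr ⟨b, fun j hj => ?_⟩
      rcases h0 j with h | h | h
      · exact h
      · exact absurd ⟨j, h⟩ ha
      · exact absurd (h2 _ _ h hb) hj
    · refine Or.inr ⟨Classical.arbitrary V, fun j _ => ?_⟩
      rcases h0 j with h | h | h
      · exact h
      · exact absurd ⟨j, h⟩ ha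
      · exact absurd ⟨j, h⟩ hb

lemma det_eq_zero_of_vecMul_eq_zero {V : Type*} [Fintype V] [DecidableEq V]
    {M : Matrix V V ℝ} {z : V → ℝ} (hz : z ≠ 0) (h : ∀ j, ∑ i, z i * M i j = 0) : M.det = 0 :=
  Matrix.exists_vecMul_eq_zero_iff.1 ⟨z, hz, funext h⟩

/-- If all columns sum to zero, the all-ones vector lies in the left kernel. Otherwise some column
has at most one nonzero entry, and expanding along it allows induction. -/
lemma abs_det_le_one_of_isArcVector (k : ℕ) (M : Matrix (Fin k) (Fin k) ℝ)
    (hM : ∀ j, IsArcVector (fun i => M i j)) : |M.det| ≤ 1 := by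
  induction k with
  | zero => simp
  | succ k ih =>
    by_cases hsum : ∀ j, ∑ i, M i j = 0
    · rw [det_eq_zero_of_vecMul_eq_zero (z := fun _ => 1) (fun h => one_ne_zero (congrFun h 0))
        (by simpa using hsum)]
      simp
    · push Not at hsum
      obtain ⟨j, hj⟩ := hsum
      obtain ⟨i, hi⟩ := (hM j).sum_eq_zero_or_eq_zero_off.resolve_left hj
      rw [Matrix.det_succ_column M j, Finset.sum_eq_single i]
      · rw [abs_mul, abs_mul, abs_pow, abs_neg, abs_one, one_pow, one_mul]
        exact mul_le_one₀ ((hM j).abs_le_one i) (abs_nonneg _)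
          (ih _ fun l => (hM _).comp Fin.succAbove_right_injective)
      · intro b _ hb
        simp [hi b hb]
      · simp

/-! ### The matrix-tree inequality -/

namespace SimpleGraph

open Finset Matrix

variable {V : Type*} [DecidableEq V]

/-- The oriented incidence matrix of `H` with an additional column of ones. -/
noncomputable def augmentedIncMatrix (H : SimpleGraph V) [DecidableRel H.Adj] :
    Matrix V (Option (Sym2 V)) ℝ :=
  fun v o => o.elim 1 fun e =>
    if e ∈ H.edgeSet then (if v = e.out.1 then 1 else 0) - (if v = e.out.2 then 1 else 0) else 0

variable (H : SimpleGraph V) [DecidableRel H.Adj]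

@[simp]
lemma augmentedIncMatrix_none (v : V) : H.augmentedIncMatrix v none = 1 := rfl

lemma augmentedIncMatrix_some_of_notMem {e : Sym2 V} (he : e ∉ H.edgeSet) (v : V) :
    H.augmentedIncMatrix v (some e) = 0 := by
  simp [augmentedIncMatrix, he]

/-- Each column of an edge has entry `1` at one end and `-1` at the other. -/
lemma exists_augmentedIncMatrix_some {e : Sym2 V} (he : e ∈ H.edgeSet) :
    ∃ a b, e = s(a, b) ∧ H.Adj a b ∧ ∀ v, H.augmentedIncMatrix v (some e) =
      (if v = a then 1 else 0) - (if v = b then 1 else 0) := by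
  have h : e = s(e.out.1, e.out.2) := (Quot.out_eq e).symm
  refine ⟨e.out.1, e.out.2, h, ?_, fun v => ?_⟩
  · rw [← mem_edgeSet, ← h]; exact he
  · simp [augmentedIncMatrix, he]

lemma isArcVector_augmentedIncMatrix (e : Sym2 V) :
    IsArcVector (fun v => H.augmentedIncMatrix v (some e)) := by
  by_cases he : e ∈ H.edgeSet
  · obtain ⟨a, b, -, hab, h⟩ := H.exists_augmentedIncMatrix_some he
    have hne := hab.ne
    simp only [h]
    refine ⟨fun i => ?_, fun i j hi hj => ?_, fun i j hi hj => ?_⟩ <;> dsimp only at *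
    · split_ifs <;> simp
    · have h (k) (hk : (if k = a then (1 : ℝ) else 0) - (if k = b then 1 else 0) = 1) : k = a := by
        by_contra hka
        rw [if_neg hka] at hk
        split_ifs at hk <;> norm_num at hk
      rw [h i hi, h j hj]
    · have h (k) (hk : (if k = a then (1 : ℝ) else 0) - (if k = b then 1 else 0) = -1) : k = b := by
        by_contra hkb
        rw [if_neg hkb] at hk
        split_ifs at hk <;> norm_num at hk
      rw [h i hi, h j hj]
  · simp only [H.augmentedIncMatrix_some_of_notMem he]
    exact ⟨by simp, by simp, by simp⟩

lemma sum_mul_augmentedIncMatrix_eq_zero [Fintype V] {e : Sym2 V} (z : V → ℝ)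
    (hz : ∀ a b, e = s(a, b) → e ∈ H.edgeSet → z a = z b) :
    ∑ v, z v * H.augmentedIncMatrix v (some e) = 0 := by
  by_cases he : e ∈ H.edgeSet
  · obtain ⟨a, b, hab, -, h⟩ := H.exists_augmentedIncMatrix_some he
    simp [h, mul_sub, hz a b hab he]
  · simp [H.augmentedIncMatrix_some_of_notMem he]

lemma augmentedIncMatrix_mul_self (v w : V) (e : Sym2 V) :
    H.augmentedIncMatrix v (some e) * H.augmentedIncMatrix w (some e) =
      (if v = w then 1 else -1) * (H.incMatrix ℝ v e * H.incMatrix ℝ w e) := by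
  by_cases he : e ∈ H.edgeSet
  · obtain ⟨a, b, rfl, hab, h⟩ := H.exists_augmentedIncMatrix_some he
    have hne := hab.ne
    rw [h, h]
    simp only [incMatrix_apply', mk'_mem_incidenceSet_iff, hab, true_and]
    by_cases h1 : v = a <;> by_cases h2 : v = b <;> by_cases h3 : w = a <;> by_cases h4 : w = b <;>
      simp_all
  · rw [H.augmentedIncMatrix_some_of_notMem he,
      H.incMatrix_of_notMem_incidenceSet fun h => he h.1]
    simp

variable [Fintype V]

lemma augmentedIncMatrix_mul_transpose (v w : V) :
    (H.augmentedIncMatrix * H.augmentedIncMatrixᵀ) v w =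
      if v = w then 1 + (H.degree v : ℝ) else if H.Adj v w then 0 else 1 := by
  have h := congrFun (congrFun (H.incMatrix_mul_transpose (R := ℝ)) v) w
  simp only [mul_apply, transpose_apply, of_apply] at h
  simp only [mul_apply, transpose_apply, Fintype.sum_option, augmentedIncMatrix_none,
    augmentedIncMatrix_mul_self, ← mul_sum, h]
  split_ifs <;> simp

/-- A selection of columns with nonzero determinant consists of the column of ones and
of the edges of a spanning tree. -/
lemma isTree_of_det_augmentedIncMatrix_ne_zero [Nonempty V] {f : V → Option (Sym2 V)}
    (hf : (H.augmentedIncMatrix.submatrix id f).det ≠ 0) :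
    Function.Injective f ∧ (∃ p, f p = none) ∧
      ∃ T : SimpleGraph V, T.IsTree ∧ T ≤ H ∧ ∀ e, e ∈ T.edgeSet ↔ some e ∈ Set.range f := by
  have hinj : Function.Injective f := by
    intro i j hij
    by_contra hne
    exact hf (det_zero_of_column_eq hne fun k => by simp [hij])
  have hmem (e) (he : some e ∈ Set.range f) : e ∈ H.edgeSet := by
    by_contra hmem
    obtain ⟨j, hj⟩ := he
    exact hf (det_eq_zero_of_column_eq_zero j fun v => by
      simpa [hj] using H.augmentedIncMatrix_some_of_notMem hmem v)
  have hnone : ∃ p, f p = none := by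
    by_contra hnone
    push Not at hnone
    refine hf (det_eq_zero_of_vecMul_eq_zero (z := fun _ => 1)
      (fun h => one_ne_zero (congrFun h (Classical.arbitrary V))) fun j => ?_)
    obtain ⟨e, he⟩ := Option.ne_none_iff_exists'.1 (hnone j)
    simpa [he] using H.sum_mul_augmentedIncMatrix_eq_zero (e := e) (fun _ => 1) fun _ _ _ _ => rfl
  let T : SimpleGraph V := fromEdgeSet {e | some e ∈ Set.range f}
  have hT (e) : e ∈ T.edgeSet ↔ some e ∈ Set.range f := by
    rw [edgeSet_fromEdgeSet]
    exact ⟨fun h => h.1, fun h => ⟨h, H.not_isDiag_of_mem_edgeSet (hmem e h)⟩⟩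
  refine ⟨hinj, hnone, T, ?_, ?_, hT⟩
  · rw [isTree_iff_connected_and_card]
    constructor
    · refine ⟨fun u v => ?_⟩
      by_contra huv
      classical
      -- If `T` is disconnected, the centred indicator of the component of `u`, scaled by `n`, is a
      -- left kernel vector: it sums to zero and is constant along edges of `T`.
      let c : ℝ := #{w | T.Reachable u w}
      have hc : c < Fintype.card V := by
        have : #{w | T.Reachable u w} < Fintype.card V :=
          card_lt_univ_of_notMem (x := v) (by simpa using huv)
        exact Nat.cast_lt.2 this
      refine hf (det_eq_zero_of_vecMul_eq_zero
        (z := fun w => Fintype.card V * (if T.Reachable u w then 1 else 0) - c)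
        (fun h => ?_) fun j => ?_)
      · have := congrFun h u
        simp at this
        linarith
      · cases hj : f j with
        | none =>
          simp only [submatrix_apply, id, hj, augmentedIncMatrix_none, mul_one, sum_sub_distrib,
            sum_const, card_univ, nsmul_eq_mul]
          rw [← mul_sum, sum_boole]
          exact sub_self ((Fintype.card V : ℝ) * c)
        | some e =>
          have := H.sum_mul_augmentedIncMatrix_eq_zero (e := e)
            (fun w => Fintype.card V * (if T.Reachable u w then 1 else 0) - c) fun a b hab _ => by
              have hadj : T.Adj a b := by
                rw [← mem_edgeSet, ← hab, hT]
                exact ⟨j, hj⟩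
              have : T.Reachable u a ↔ T.Reachable u b :=
                ⟨fun h => h.trans hadj.reachable, fun h => h.trans hadj.symm.reachable⟩
              simp only [this]
          simpa [hj] using this
    · classical
      -- The columns selected are the edges of `T` and the column of ones, so `T` has one edge fewer
      -- than vertices.
      have himg : univ.image f = insertNone T.edgeFinset := by
        ext o
        cases o with
        | none => simpa using hnone
        | some e => simpa using (hT e).symm
      rw [Nat.card_eq_fintype_card, Nat.card_eq_fintype_card, ← edgeFinset_card,
        ← card_insertNone, ← himg, card_image_of_injective _ hinj, card_univ]
  · rw [← edgeSet_subset_edgeSet]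
    exact fun e he => hmem e ((hT e).1 he)

lemma abs_det_augmentedIncMatrix_le {n : ℕ} (H : SimpleGraph (Fin n)) [DecidableRel H.Adj]
    {f : Fin n → Option (Sym2 (Fin n))} (hinj : Function.Injective f) {p : Fin n}
    (hp : f p = none) : |(H.augmentedIncMatrix.submatrix id f).det| ≤ n := by
  cases n with
  | zero => exact p.elim0
  | succ k =>
    set M := H.augmentedIncMatrix.submatrix id f with hM
    have hne (j) (hj : j ≠ p) : ∃ e, f j = some e :=
      Option.ne_none_iff_exists'.1 fun h => hj (hinj (h.trans hp.symm))
    -- Adding all rows to row 0 leaves `n = k + 1` in the column of ones and 0 in every edge column.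
    have hsum : M.det = (M.updateRow 0 (fun j => if j = p then (k + 1 : ℝ) else 0)).det := by
      have h := det_updateRow_sum M 0 fun _ => 1
      rw [one_smul] at h
      rw [← h]
      congr 2
      ext j
      simp only [one_smul]
      rw [show (∑ i, M i) j = ∑ i, M i j from Finset.sum_apply j univ M]
      split_ifs with hj
      · subst hj
        simp [hM, hp]
      · obtain ⟨e, he⟩ := hne j hj
        have := H.sum_mul_augmentedIncMatrix_eq_zero (e := e) (fun _ => 1) fun _ _ _ _ => rfl
        simpa [hM, he] using this
    rw [hsum, det_succ_row_zero, Finset.sum_eq_single p]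
    · rw [abs_mul, abs_mul, abs_pow, abs_neg, abs_one, one_pow, one_mul, updateRow_self, if_pos rfl,
        Nat.cast_succ, abs_of_nonneg (by positivity : (0 : ℝ) ≤ k + 1)]
      refine mul_le_of_le_one_right (by positivity) (abs_det_le_one_of_isArcVector _ _ fun j => ?_)
      obtain ⟨e, he⟩ := hne (p.succAbove j) (Fin.succAbove_ne p j)
      have := (H.isArcVector_augmentedIncMatrix e).comp (Fin.succ_injective k)
      convert this using 2 with i
      simp [hM, he, updateRow_apply, Fin.succ_ne_zero]
    · intro b _ hb
      simp [hb]
    · simp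

/-- The determinant of `A * Aᵀ`, for `A` the augmented incidence matrix of `H`, is at most
`n ^ 2` times the number of spanning trees of `H`. -/
lemma det_augmentedIncMatrix_mul_transpose_le {n : ℕ} [NeZero n] (H : SimpleGraph (Fin n))
    [DecidableRel H.Adj] : (H.augmentedIncMatrix * H.augmentedIncMatrixᵀ).det ≤
      (n : ℝ) ^ 2 * ({T | T.IsTree ∧ T ≤ H} : Set (SimpleGraph (Fin n))).ncard := by
  classical
  let s : Finset (Fin n → Option (Sym2 (Fin n))) :=
    {f | (H.augmentedIncMatrix.submatrix id f).det ≠ 0}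
  let t : Finset (SimpleGraph (Fin n)) := {T | T.IsTree ∧ T ≤ H}
  have ht : ({T | T.IsTree ∧ T ≤ H} : Set (SimpleGraph (Fin n))).ncard = #t := by
    rw [← Set.ncard_coe_finset]
    simp [t]
  have hs {f} (hf : f ∈ s) := H.isTree_of_det_augmentedIncMatrix_ne_zero (mem_filter.1 hf).2
  let g (f : Fin n → Option (Sym2 (Fin n))) : SimpleGraph (Fin n) :=
    fromEdgeSet {e | some e ∈ Set.range f}
  have hg {f} (hf : f ∈ s) : g f ∈ t ∧ ∀ e, e ∈ (g f).edgeSet ↔ some e ∈ Set.range f := by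
    obtain ⟨-, -, T, hT, hTH, he⟩ := hs hf
    have : g f = T := by
      rw [← fromEdgeSet_edgeSet T]
      exact congrArg fromEdgeSet (Set.ext fun e => (he e).symm)
    rw [this]
    exact ⟨by simp [t, hT, hTH], he⟩
  -- Selections giving the same tree differ by a permutation; this `n!` cancels the one in
  -- Cauchy–Binet.
  have hfib (T) : #{f ∈ s | g f = T} ≤ n.factorial := by
    rcases ({f ∈ s | g f = T}).eq_empty_or_nonempty with h0 | ⟨f₀, hf₀⟩
    · simp [h0]
    have hf₀s := (mem_filter.1 hf₀).1
    obtain rfl := (mem_filter.1 hf₀).2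
    calc #{f ∈ s | g f = g f₀}
        ≤ #(image (fun σ : Equiv.Perm (Fin n) => f₀ ∘ σ) univ) := by
          refine card_le_card fun f hf => ?_
          obtain ⟨hf, hgf⟩ := mem_filter.1 hf
          have hrange : Set.range f = Set.range f₀ := by
            ext o
            cases o with
            | none => exact iff_of_true (hs hf).2.1 (hs hf₀s).2.1
            | some e => rw [← (hg hf).2, hgf, (hg hf₀s).2]
          refine mem_image.2 ⟨(Equiv.ofInjective f (hs hf).1).trans
            ((Equiv.setCongr hrange).trans (Equiv.ofInjective f₀ (hs hf₀s).1).symm), mem_univ _, ?_⟩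
          ext1 i
          simp [Equiv.apply_ofInjective_symm]
      _ ≤ n.factorial := by
          refine card_image_le.trans ?_
          rw [card_univ, Fintype.card_perm, Fintype.card_fin]
  have hcard : (#s : ℝ) ≤ n.factorial * #t := by
    exact_mod_cast card_le_mul_card_image_of_maps_to (fun f hf => (hg hf).1) _ fun T _ => hfib T
  have hsum : (n.factorial : ℝ) * (H.augmentedIncMatrix * H.augmentedIncMatrixᵀ).det ≤
      #s * (n : ℝ) ^ 2 := by
    have h := factorial_mul_det_mul_transpose H.augmentedIncMatrix
    rw [Fintype.card_fin] at h
    rw [h, ← sum_filter_of_ne (p := fun f => (H.augmentedIncMatrix.submatrix id f).det ≠ 0)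
      fun f _ hf h0 => hf (by simp [h0]), ← nsmul_eq_mul]
    refine sum_le_card_nsmul _ _ _ fun f hf => ?_
    obtain ⟨p, hp⟩ := (hs hf).2.1
    exact sq_le_sq' (by linarith [neg_abs_le (H.augmentedIncMatrix.submatrix id f).det,
      H.abs_det_augmentedIncMatrix_le (hs hf).1 hp])
      (le_of_abs_le (H.abs_det_augmentedIncMatrix_le (hs hf).1 hp))
  rw [ht]
  have hpos : (0 : ℝ) < n.factorial := by exact_mod_cast n.factorial_pos
  refine le_of_mul_le_mul_left (hsum.trans ?_) hpos
  nlinarith [mul_le_mul_of_nonneg_right hcard (sq_nonneg (n : ℝ))]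

/-- An acyclic graph has fewer edges than vertices. -/
lemma IsAcyclic.card_edgeFinset_lt {V : Type*} [Fintype V] [Nonempty V] {G : SimpleGraph V}
    [DecidableRel G.Adj] (hG : G.IsAcyclic) : #G.edgeFinset < Fintype.card V := by
  classical
  obtain ⟨T, hle, hT⟩ := Finite.exists_le_maximal hG
  rw [maximal_isAcyclic_iff_isTree] at hT
  have := hT.card_edgeFinset
  have := card_le_card (edgeFinset_mono hle)
  lia

end SimpleGraph

/-! ### The eigenvalue bound -/

/-- By convexity the exponential lies below its chord on `[0, 2 / 3]`, and `exp (-4 / 3) ≤ 1 / 3`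
puts that chord below `1 - x`. -/
lemma exp_neg_two_mul_le_one_sub {x : ℝ} (h0 : 0 ≤ x) (h1 : x ≤ 2 / 3) :
    Real.exp (-2 * x) ≤ 1 - x := by
  have hexp : Real.exp (-2 * (2 / 3)) ≤ 1 / 3 := by
    rw [show (-2 * (2 / 3) : ℝ) = -(4 / 3) by norm_num, Real.exp_neg, one_div]
    refine inv_anti₀ (by norm_num) ?_
    have := Real.quadratic_le_exp_of_nonneg (x := 4 / 3) (by norm_num)
    linarith
  have hconv := convexOn_exp.2 (Set.mem_univ (0 : ℝ)) (Set.mem_univ (-2 * (2 / 3) : ℝ))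
    (show 0 ≤ 1 - 3 / 2 * x by linarith) (show 0 ≤ 3 / 2 * x by linarith) (by ring)
  simp only [smul_eq_mul, Real.exp_zero, mul_zero, zero_add, mul_one] at hconv
  rw [show 3 / 2 * x * (-2 * (2 / 3)) = -2 * x by ring] at hconv
  nlinarith [mul_le_mul_of_nonneg_left hexp (by linarith : (0 : ℝ) ≤ 3 / 2 * x)]

open Finset Matrix in
/-- A lower bound for the determinant of a diagonally dominant Hermitian matrix. -/
lemma exp_neg_four_mul_pow_le_det {n : ℕ} (hn : 0 < n) {M : Matrix (Fin n) (Fin n) ℝ}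
    (hM : M.IsHermitian) (d : Fin n → ℝ) (hdiag : ∀ i, M i i = n - d i)
    (hoff : ∀ i, ∑ j ∈ univ.erase i, ‖M i j‖ = d i) (hd : ∀ i, 2 * d i ≤ 2 / 3 * n)
    (hsum : ∑ i, d i ≤ 2 * n) : Real.exp (-4) * (n : ℝ) ^ n ≤ M.det := by
  have hn' : (0 : ℝ) < n := by exact_mod_cast hn
  let x (i : Fin n) : ℝ := 1 - hM.eigenvalues i / n
  have hx (i) : hM.eigenvalues i = n * (1 - x i) := by
    simp only [x]
    field_simp
    ring
  have hball (i) : 0 ≤ x i ∧ x i ≤ 2 / 3 := by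
    have heig : Module.End.HasEigenvalue (Matrix.toLin' M) (hM.eigenvalues i) := by
      refine Module.End.hasEigenvalue_of_hasEigenvector
        (x := (hM.eigenvectorBasis i : Fin n → ℝ)) ?_
      rw [Module.End.hasEigenvector_iff, Module.End.mem_eigenspace_iff]
      refine ⟨by simpa using hM.mulVec_eigenvectorBasis i, fun h => ?_⟩
      exact hM.eigenvectorBasis.toBasis.ne_zero i (by ext j; simpa using congrFun h j)
    -- Gershgorin: the disc has centre `n - d k` and radius `d k`, so the eigenvalue lies in `[n - 2
    -- * d k, n]`.
    obtain ⟨k, hk⟩ := eigenvalue_mem_ball heig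
    rw [hoff, hdiag, Metric.mem_closedBall, Real.dist_eq, abs_le, hx] at hk
    have := hd k
    constructor <;> refine le_of_mul_le_mul_left ?_ hn' <;> linarith
  have hxsum : ∑ i, x i ≤ 2 := by
    have htr : M.trace = ∑ i, hM.eigenvalues i := by simpa using hM.trace_eq_sum_eigenvalues
    simp only [trace, diag_apply, hdiag, hx, sum_sub_distrib, ← mul_sum, sum_const, card_univ,
      Fintype.card_fin, nsmul_eq_mul, mul_one] at htr
    refine le_of_mul_le_mul_left ?_ hn'
    linarith
  calc Real.exp (-4) * (n : ℝ) ^ n ≤ Real.exp (∑ i, -2 * x i) * (n : ℝ) ^ n := by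
        gcongr
        rw [← mul_sum]
        linarith
    _ = ∏ i, (n * Real.exp (-2 * x i)) := by
        rw [Real.exp_sum, prod_mul_distrib, prod_const, card_univ, Fintype.card_fin, mul_comm]
    _ ≤ ∏ i, hM.eigenvalues i := by
        refine prod_le_prod (fun i _ => by positivity) fun i _ => ?_
        rw [hx]
        gcongr
        exact exp_neg_two_mul_le_one_sub (hball i).1 (hball i).2
    _ = M.det := by simpa using hM.det_eq_prod_eigenvalues.symm

/-! ### Application to the complement of a forest -/

open Finset in
/-- The degrees of a graph that is not star-like are small. -/
lemma degree_lt_of_not_isStarLike {n : ℕ} (hn : 1 ≤ n) {T : SimpleGraph (Fin n)}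
    [DecidableRel T.Adj] (hT : ¬ IsStarLike 6 T) (v : Fin n) :
    (T.degree v : ℝ) < (n - 1) / 6 + 1 := by
  have hn' : (1 : ℝ) ≤ n := by exact_mod_cast hn
  by_cases h0 : T.degree v = 0
  · rw [h0]
    push_cast
    linarith
  obtain ⟨w, hw⟩ := (T.degree_pos_iff_exists_adj v).1 (Nat.pos_of_ne_zero h0)
  have hlt : ((otherIncidentEdges T s(v, w)).ncard : ℝ) < (n - 1) / 6 := by
    by_contra h
    exact hT ⟨s(v, w), hw, by push_cast; linarith⟩
  have hsub : (((T.incidenceFinset v).erase s(v, w) : Finset (Sym2 (Fin n))) : Set _) ⊆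
      otherIncidentEdges T s(v, w) := by
    intro e he
    simp only [coe_erase, Set.mem_sdiff, mem_coe, SimpleGraph.mem_incidenceFinset,
      Set.mem_singleton_iff] at he
    exact ⟨he.1.1, he.2, v, Sym2.mem_mk_left _ _, he.1.2⟩
  have hcard := Set.ncard_le_ncard hsub (Set.toFinite _)
  rw [Set.ncard_coe_finset,
    card_erase_of_mem (by simpa [SimpleGraph.mk'_mem_incidenceSet_iff] using hw),
    SimpleGraph.card_incidenceFinset_eq_degree, Nat.sub_le_iff_le_add] at hcard
  have : (T.degree v : ℝ) ≤ (otherIncidentEdges T s(v, w)).ncard + 1 := by exact_mod_cast hcard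
  linarith

open Finset Matrix in
/-- The graph avoided by a forest of small degrees has many spanning trees. -/
lemma exp_neg_four_mul_pow_le_ncard_isTree_le_compl {n : ℕ} (hn : 5 ≤ n) {G : SimpleGraph (Fin n)}
    (hG : G.IsAcyclic) (hstar : ¬ IsStarLike 6 G) :
    Real.exp (-4) * (n : ℝ) ^ (n - 2) ≤
      ({T | T.IsTree ∧ T ≤ Gᶜ} : Set (SimpleGraph (Fin n))).ncard := by
  classical
  have : NeZero n := ⟨by lia⟩
  have hn5 : (5 : ℝ) ≤ n := by exact_mod_cast hn
  have hdeg (v) : (Gᶜ.degree v : ℝ) = n - 1 - G.degree v := by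
    have h := G.degree_compl v
    have h' := G.degree_lt_card_verts v
    rw [Fintype.card_fin] at h h'
    rw [h, Nat.cast_sub (by lia), Nat.cast_sub (by lia), Nat.cast_one]
  have hentry (v w) : (Gᶜ.augmentedIncMatrix * Gᶜ.augmentedIncMatrixᵀ) v w =
      if v = w then (n - G.degree v : ℝ) else if G.Adj v w then 1 else 0 := by
    rw [SimpleGraph.augmentedIncMatrix_mul_transpose]
    split_ifs <;> simp_all
    ring
  have hdet : Real.exp (-4) * (n : ℝ) ^ n ≤
      (Gᶜ.augmentedIncMatrix * Gᶜ.augmentedIncMatrixᵀ).det := by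
    refine exp_neg_four_mul_pow_le_det (by lia) ?_ (fun v => G.degree v) (fun v => ?_) (fun v => ?_)
      (fun v => ?_) ?_
    · simpa using isHermitian_mul_conjTranspose_self Gᶜ.augmentedIncMatrix
    · simp [hentry]
    · rw [SimpleGraph.degree_eq_sum_if_adj, ← add_sum_erase _ _ (mem_univ v)]
      simp only [SimpleGraph.irrefl, if_false, zero_add]
      refine sum_congr rfl fun w hw => ?_
      rw [hentry, if_neg (ne_of_mem_erase hw).symm]
      split_ifs <;> simp
    -- `(n - 1) / 6 + 1 ≤ n / 3` holds exactly when `n ≥ 5`.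
    · have := degree_lt_of_not_isStarLike (by lia) hstar v
      linarith
    · have h1 := G.sum_degrees_eq_twice_card_edges
      have h2 := hG.card_edgeFinset_lt
      rw [Fintype.card_fin] at h2
      have h3 : ∑ v, G.degree v ≤ 2 * n := by lia
      exact_mod_cast h3
  have h := hdet.trans (SimpleGraph.det_augmentedIncMatrix_mul_transpose_le Gᶜ)
  have hpow : (n : ℝ) ^ n = n ^ 2 * n ^ (n - 2) := by
    rw [← pow_add]
    congr 1
    lia
  rw [hpow, mul_left_comm] at h
  exact le_of_mul_le_mul_left h (by positivity)

lemma avoids_iff_le_compl {n : ℕ} {T G : SimpleGraph (Fin n)} : Avoids T G ↔ T ≤ Gᶜ := by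
  rw [Avoids, SimpleGraph.disjoint_edgeSet, ← le_compl_iff_disjoint_right]

theorem lemma3p5 (n : ℕ) (hn : 5 ≤ n) (T₀ : SimpleGraph (Fin n)) (hforest : T₀.IsAcyclic)
    (hT₀ : ¬ IsStarLike 6 T₀) :
    Real.exp (-4) * (n : ℝ) ^ (n - 2) ≤
        (({T | T ∈ spanningTrees n ∧ Avoids T T₀} : Set (SimpleGraph (Fin n))).ncard : ℝ) ∧
      Real.exp (-4) * (n : ℝ) ^ (n - 2) ≤
        ((spanningTreesContainingAvoiding T₀ ⊥).ncard : ℝ) := by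
  have h := exp_neg_four_mul_pow_le_ncard_isTree_le_compl hn hforest hT₀
  constructor
  · simpa only [avoids_iff_le_compl, spanningTrees, Set.mem_ofPred_eq] using h
  · convert h using 3
    ext T
    simp [spanningTreesContainingAvoiding, spanningTreesContaining, spanningTrees,
      ← avoids_iff_le_compl, Avoids, Set.disjoint_iff_inter_eq_empty]
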